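/- Let $n,m\ge 1$ be integers, let $O\subseteq\mathbb{R}^n$ be open and let $D_1,\dots,D_m\subseteq\partial O$ be closed (possibly empty) sets; put $\mathcal D=(D_i)_{i=1}^m$. Let $\mathrm W^{1,2}_{D_i}(O)$ be the closure in $\mathrm W^{1,2}(O)$ of the restrictions to $O$ of all $u\in \mathrm C_0^\infty(\mathbb{R}^n)$ with $\operatorname{dist}(\operatorname{supp}u,D_i)>0$, and $\mathbb W^{1,2}_{\mathcal D}(O)=\bigoplus_{i=1}^m \mathrm W^{1,2}_{D_i}(O)$. Put $N=(n+1)m$. Let $T_{\mathcal D}=(1,\nabla)^t$ be the operator from $\mathrm L^2(O)^m$ to $\mathrm L^2(O)^N$ with domain $\mathbb W^{1,2}_{\mathcal D}(O)$, let $T_{\mathcal D}^*$ be its Hilbert space adjoint, and let $M_{\mathcal D}=T_{\mathcal D}T_{\mathcal D}^*$ with maximal domain. Let $A,b,c,d$ be matrices with entries in $\mathrm L^\infty(O;\mathbb{C})$ of sizes $nm\times nm$, $nm\times m$, $m\times nm$ and $m\times m$, and let $B$ be the bounded multiplication operator on $\mathrm L^2(O)^N$ by $\begin{bmatrix} d &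 c\\ b& A\end{bmatrix}$. Suppose that there is $\lambda>0$ such that $$\operatorname{Re}\int_O \bigl(A\nabla u\cdot\overline{\nabla u}+bu\cdot\overline{\nabla u}+(c\nabla u)\cdot\overline u+(du)\cdot\overline u\bigr)\,dx\;\ge\;\lambda\bigl(\|u\|_2^2+\|\nabla u\|_2^2\bigr)\qquad (u\in\mathbb W^{1,2}_{\mathcal D}(O)).$$ Then the operator $M_{\mathcal D}B$ in $\mathrm L^2(O)^N$, with domain $\{F: BF\in\operatorname{dom}(M_{\mathcal D})\}$, is sectorial of some angle $\omega\in[0,\pi/2)$: its spectrum is contained in the closed sector $\{0\}\cup\{z\neq 0:|\arg z|\le\omega\}$ and, for every $\varphi\in(\omega,\pi)$, the operators $z(z-M_{\mathcal D}B)^{-1}$ are bounded uniformly over all $z\ne0$ with $|\arg z|>\varphi$. Moreover, for every $t>0$ the operator $1+t^2M_{\mathcal D}B$ has a bounded everywhere defined inverse, the operator $t\,T_{\mathcal D}^*B(1+t^2M_{\mathcal D}B)^{-1}$ is defined on all of $\mathrm L^2(O)^N$ and bounded into $\mathrm L^2(O)^m$, and $$\sup_{t>0}\bigl\|t\,T_{\mathcal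 D}^*B(1+t^2M_{\mathcal D}B)^{-1}\bigr\|_{\mathcal L(\mathrm L^2(O)^N,\mathrm L^2(O)^m)}<\infty .$$ -/

import Mathlib

open MeasureTheory TopologicalSpace
open scoped ENNReal ContDiff InnerProductSpace LinearPMap ComplexConjugate

noncomputable section

namespace Kato

/-! ### Unbounded operators -/

section Operators

variable {E F G : Type*} [NormedAddCommGroup E] [NormedSpace ℂ E]
  [NormedAddCommGroup F] [NormedSpace ℂ F] [NormedAddCommGroup G] [NormedSpace ℂ G]

/-- The composition `g ∘ f` of unbounded operators with its maximal domain
`{x ∈ dom f : f x ∈ dom g}`. -/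
def compMax (g : F →ₗ.[ℂ] G) (f : E →ₗ.[ℂ] F) : E →ₗ.[ℂ] G where
  domain :=
    { carrier := {x | ∃ h : x ∈ f.domain, f ⟨x, h⟩ ∈ g.domain}
      zero_mem' := ⟨f.domain.zero_mem, by
        have : (⟨0, f.domain.zero_mem⟩ : f.domain) = 0 := rfl
        rw [this, f.map_zero]; exact g.domain.zero_mem⟩
      add_mem' := by
        rintro x y ⟨hx, hgx⟩ ⟨hy, hgy⟩
        refine ⟨f.domain.add_mem hx hy, ?_⟩
        have := f.map_add ⟨x, hx⟩ ⟨y, hy⟩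
        exact this ▸ g.domain.add_mem hgx hgy
      smul_mem' := by
        rintro c x ⟨hx, hgx⟩
        refine ⟨f.domain.smul_mem c hx, ?_⟩
        have := f.map_smul c ⟨x, hx⟩
        exact this ▸ g.domain.smul_mem c hgx }
  toFun :=
    { toFun := fun x => g ⟨f ⟨x.1, x.2.1⟩, x.2.2⟩
      map_add' := by
        rintro ⟨x, hx, hgx⟩ ⟨y, hy, hgy⟩
        rw [← g.map_add]
        congr 1
        exact Subtype.ext (f.map_add ⟨x, hx⟩ ⟨y, hy⟩)
      map_smul' := by
        rintro c ⟨x, hx, hgx⟩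
        rw [RingHom.id_apply, ← g.map_smul]
        congr 1
        exact Subtype.ext (f.map_smul c ⟨x, hx⟩) }

/-- An everywhere defined bounded operator, regarded as an unbounded operator with full domain. -/
def ofBounded (S : E →L[ℂ] F) : E →ₗ.[ℂ] F := (S : E →ₗ[ℂ] F).toPMap ⊤

/-- `R` is the bounded, everywhere defined, two-sided inverse of `A : dom A ⊆ E → F`. -/
def IsBoundedInverse (A : E →ₗ.[ℂ] F) (R : F →L[ℂ] E) : Prop :=
  (∀ f : F, ∃ h : R f ∈ A.domain, A ⟨R f, h⟩ = f) ∧ ∀ u : A.domain, R (A u) = u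

/-- `R = (z - A)⁻¹` is the resolvent of `A` at `z`, so that `z` belongs to the resolvent set. -/
def IsResolventAt (A : E →ₗ.[ℂ] E) (z : ℂ) (R : E →L[ℂ] E) : Prop :=
  IsBoundedInverse (z • ofBounded (ContinuousLinearMap.id ℂ E) - A) R

/-- The spectrum of an unbounded operator: the complement of its resolvent set. -/
def spec (A : E →ₗ.[ℂ] E) : Set ℂ := {z | ¬ ∃ R : E →L[ℂ] E, IsResolventAt A z R}

/-- The closed sector of opening angle `2φ` around the positive real axis, for `φ ∈ [0, π)`
(it contains `0` since `Complex.arg 0 = 0`). -/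
def closedSector (φ : ℝ) : Set ℂ := {z | |z.arg| ≤ φ}

/-- Sectoriality of angle `θ`: the spectrum is contained in the closed sector of angle `θ`, and
for every `φ ∈ (θ, π)` the operators `z (z - A)⁻¹` are bounded uniformly for `z` outside the
closed sector of angle `φ`. -/
def IsSectorialOfAngle (A : E →ₗ.[ℂ] E) (θ : ℝ) : Prop :=
  spec A ⊆ closedSector θ ∧
  ∀ φ : ℝ, θ < φ → φ < Real.pi → ∃ C : ℝ, ∀ z : ℂ, z ∉ closedSector φ →
    ∀ R : E →L[ℂ] E, IsResolventAt A z R → ‖z • R‖ ≤ C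

end Operators

/-! ### Function spaces -/

/-- `L²(O)`, complex valued. -/
abbrev L2 {n : ℕ} (O : Opens (EuclideanSpace ℝ (Fin n))) : Type :=
  Lp ℂ 2 (volume.restrict (O : Set (EuclideanSpace ℝ (Fin n))))

/-- `L^∞(O)`, complex valued. -/
abbrev Linf {n : ℕ} (O : Opens (EuclideanSpace ℝ (Fin n))) : Type :=
  Lp ℂ ∞ (volume.restrict (O : Set (EuclideanSpace ℝ (Fin n))))

/-- The Hilbert space `L²(O)^ι`, with norm `‖F‖² = ∑ k, ‖F k‖²`. -/
abbrev L2v {n : ℕ} (O : Opens (EuclideanSpace ℝ (Fin n))) (ι : Type) [Fintype ι] : Type :=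
  PiLp 2 (fun _ : ι => L2 O)

variable {n m : ℕ}

/-- `g` is the weak (distributional) gradient of `u` on `O`. -/
def IsWeakGradient (O : Opens (EuclideanSpace ℝ (Fin n))) (u : L2 O) (g : L2v O (Fin n)) : Prop :=
  ∀ φ : EuclideanSpace ℝ (Fin n) → ℂ, ContDiff ℝ ∞ φ → HasCompactSupport φ →
    tsupport φ ⊆ O → ∀ j : Fin n,
      ∫ x in (O : Set (EuclideanSpace ℝ (Fin n))),
          u x * fderiv ℝ φ x (EuclideanSpace.single j 1)
        = - ∫ x in (O : Set (EuclideanSpace ℝ (Fin n))), g j x * φ x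

/-- Products of `L²` functions with continuous compactly supported functions are integrable. -/
theorem integrable_mul_test (O : Opens (EuclideanSpace ℝ (Fin n))) (u : L2 O)
    {ψ : EuclideanSpace ℝ (Fin n) → ℂ} (hψ : Continuous ψ) (hc : HasCompactSupport ψ) :
    Integrable (fun x => u x * ψ x)
      (volume.restrict (O : Set (EuclideanSpace ℝ (Fin n)))) :=
  (Lp.memLp u).integrable_mul (p := 2) (q := 2) (hψ.memLp_of_hasCompactSupport hc)

theorem continuous_pderiv {φ : EuclideanSpace ℝ (Fin n) → ℂ} (hφ : ContDiff ℝ ∞ φ)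
    (v : EuclideanSpace ℝ (Fin n)) : Continuous (fun x => fderiv ℝ φ x v) :=
  (hφ.continuous_fderiv (by simp)).clm_apply continuous_const

theorem hasCompactSupport_pderiv {φ : EuclideanSpace ℝ (Fin n) → ℂ} (hφ : HasCompactSupport φ)
    (v : EuclideanSpace ℝ (Fin n)) : HasCompactSupport (fun x => fderiv ℝ φ x v) :=
  hφ.fderiv_apply (𝕜 := ℝ) v

theorem IsWeakGradient.add {O : Opens (EuclideanSpace ℝ (Fin n))} {u v : L2 O}
    {g h : L2v O (Fin n)} (hu : IsWeakGradient O u g) (hv : IsWeakGradient O v h) :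
    IsWeakGradient O (u + v) (g + h) := by
  intro φ hφ hc hs j
  have h1 := hu φ hφ hc hs j
  have h2 := hv φ hφ hc hs j
  have hd := continuous_pderiv hφ (EuclideanSpace.single j 1)
  have hdc := hasCompactSupport_pderiv hc (EuclideanSpace.single j 1)
  have e1 : ∫ x in (O : Set (EuclideanSpace ℝ (Fin n))),
      (u + v : L2 O) x * fderiv ℝ φ x (EuclideanSpace.single j 1) =
      ∫ x in (O : Set (EuclideanSpace ℝ (Fin n))),
        (u x * fderiv ℝ φ x (EuclideanSpace.single j 1)
          + v x * fderiv ℝ φ x (EuclideanSpace.single j 1)) := by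
    apply integral_congr_ae
    filter_upwards [Lp.coeFn_add u v] with x hx
    rw [hx, Pi.add_apply, add_mul]
  have e2 : ∫ x in (O : Set (EuclideanSpace ℝ (Fin n))), (g + h) j x * φ x =
      ∫ x in (O : Set (EuclideanSpace ℝ (Fin n))), (g j x * φ x + h j x * φ x) := by
    apply integral_congr_ae
    filter_upwards [Lp.coeFn_add (g j) (h j)] with x hx
    rw [PiLp.add_apply, hx, Pi.add_apply, add_mul]
  rw [e1, e2, integral_add (integrable_mul_test O u hd hdc) (integrable_mul_test O v hd hdc),
    integral_add (integrable_mul_test O _ hφ.continuous hc)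
      (integrable_mul_test O _ hφ.continuous hc), h1, h2, neg_add]

theorem IsWeakGradient.smul {O : Opens (EuclideanSpace ℝ (Fin n))} {u : L2 O}
    {g : L2v O (Fin n)} (c : ℂ) (hu : IsWeakGradient O u g) :
    IsWeakGradient O (c • u) (c • g) := by
  intro φ hφ hc hs j
  have h1 := hu φ hφ hc hs j
  have e1 : ∫ x in (O : Set (EuclideanSpace ℝ (Fin n))),
      (c • u : L2 O) x * fderiv ℝ φ x (EuclideanSpace.single j 1) =
      ∫ x in (O : Set (EuclideanSpace ℝ (Fin n))),
        c * (u x * fderiv ℝ φ x (EuclideanSpace.single j 1)) := by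
    apply integral_congr_ae
    filter_upwards [Lp.coeFn_smul c u] with x hx
    rw [hx, Pi.smul_apply, smul_eq_mul, mul_assoc]
  have e2 : ∫ x in (O : Set (EuclideanSpace ℝ (Fin n))), (c • g) j x * φ x =
      ∫ x in (O : Set (EuclideanSpace ℝ (Fin n))), c * (g j x * φ x) := by
    apply integral_congr_ae
    filter_upwards [Lp.coeFn_smul c (g j)] with x hx
    rw [PiLp.smul_apply, hx, Pi.smul_apply, smul_eq_mul, mul_assoc]
  rw [e1, e2, integral_const_mul, integral_const_mul, h1, mul_neg]

/-- Weak gradients are unique. -/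
theorem IsWeakGradient.unique {O : Opens (EuclideanSpace ℝ (Fin n))} {u : L2 O}
    {g h : L2v O (Fin n)} (hg : IsWeakGradient O u g) (hh : IsWeakGradient O u h) : g = h := by
  ext1 j
  rw [← sub_eq_zero]
  apply (Lp.eq_zero_iff_ae_eq_zero).2
  have hO := O.isOpen
  have key : ∀ᵐ x ∂(volume.restrict (O : Set (EuclideanSpace ℝ (Fin n)))),
      x ∈ (O : Set (EuclideanSpace ℝ (Fin n))) → (g j - h j : L2 O) x = 0 := by
    refine hO.ae_eq_zero_of_integral_contDiff_smul_eq_zero ?_ ?_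
    · exact ((Lp.memLp (g j - h j)).locallyIntegrable (by norm_num)).locallyIntegrableOn _
    · intro φ hφ hc hs
      have hφ' : ContDiff ℝ ∞ (fun x => (φ x : ℂ)) := Complex.ofRealCLM.contDiff.comp hφ
      have hc' : HasCompactSupport (fun x => (φ x : ℂ)) :=
        hc.comp_left (g := fun r : ℝ => (r : ℂ)) Complex.ofReal_zero
      have hs' : tsupport (fun x => (φ x : ℂ)) ⊆ O :=
        (closure_mono (Function.support_comp_subset Complex.ofReal_zero φ)).trans hs
      have h1 := hg _ hφ' hc' hs' j
      have h2 := hh _ hφ' hc' hs' j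
      rw [h1, neg_inj] at h2
      have e : ∫ x in (O : Set (EuclideanSpace ℝ (Fin n))), φ x • (g j - h j : L2 O) x =
          ∫ x in (O : Set (EuclideanSpace ℝ (Fin n))),
            (g j x * (φ x : ℂ) - h j x * (φ x : ℂ)) := by
        apply integral_congr_ae
        filter_upwards [Lp.coeFn_sub (g j) (h j)] with x hx
        rw [hx, Pi.sub_apply, Complex.real_smul]
        ring
      rw [e, integral_sub (integrable_mul_test O _ hφ'.continuous hc')
        (integrable_mul_test O _ hφ'.continuous hc'), h2, sub_self]
  filter_upwards [key, ae_restrict_mem hO.measurableSet] with x hx hxO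
  exact hx hxO

/-- The Sobolev space `W^{1,2}(O)`, as a subspace of `L²(O)`. -/
def W12 (O : Opens (EuclideanSpace ℝ (Fin n))) : Submodule ℂ (L2 O) where
  carrier := {u | ∃ g : L2v O (Fin n), IsWeakGradient O u g}
  zero_mem' := by
    refine ⟨0, ?_⟩
    intro φ hφ hc hs j
    have e1 : ∫ x in (O : Set (EuclideanSpace ℝ (Fin n))),
        (0 : L2 O) x * fderiv ℝ φ x (EuclideanSpace.single j 1) = 0 := by
      apply integral_eq_zero_of_ae
      filter_upwards [Lp.coeFn_zero ℂ 2
        (volume.restrict (O : Set (EuclideanSpace ℝ (Fin n))))] with x hx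
      rw [hx]; simp
    have e2 : ∫ x in (O : Set (EuclideanSpace ℝ (Fin n))),
        (0 : L2v O (Fin n)) j x * φ x = 0 := by
      apply integral_eq_zero_of_ae
      filter_upwards [Lp.coeFn_zero ℂ 2
        (volume.restrict (O : Set (EuclideanSpace ℝ (Fin n))))] with x hx
      rw [PiLp.zero_apply, hx]; simp
    rw [e1, e2, neg_zero]
  add_mem' := by
    rintro u v ⟨g, hg⟩ ⟨h, hh⟩
    exact ⟨g + h, hg.add hh⟩
  smul_mem' := by
    rintro c u ⟨g, hg⟩
    exact ⟨c • g, hg.smul c⟩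

/-- The weak gradient `∇ : W^{1,2}(O) → L²(O)^n`. -/
def grad (O : Opens (EuclideanSpace ℝ (Fin n))) : W12 O →ₗ[ℂ] L2v O (Fin n) where
  toFun u := u.2.choose
  map_add' u v := (u + v).2.choose_spec.unique (u.2.choose_spec.add v.2.choose_spec)
  map_smul' c u := (c • u).2.choose_spec.unique (u.2.choose_spec.smul c)

theorem grad_spec (O : Opens (EuclideanSpace ℝ (Fin n))) (u : W12 O) :
    IsWeakGradient O u (grad O u) := u.2.choose_spec

/-- `φ ∈ C_0^∞(ℝⁿ)` with `dist(supp φ, D) > 0` (no condition if `D = ∅`). -/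
def IsTestAwayFrom (D : Set (EuclideanSpace ℝ (Fin n)))
    (φ : EuclideanSpace ℝ (Fin n) → ℂ) : Prop :=
  ContDiff ℝ ∞ φ ∧ HasCompactSupport φ ∧
    ∃ ε : ℝ, 0 < ε ∧ ∀ x ∈ tsupport φ, ∀ y ∈ D, ε ≤ dist x y

theorem isTestAwayFrom_zero (D : Set (EuclideanSpace ℝ (Fin n))) :
    IsTestAwayFrom D (fun _ => 0) :=
  ⟨contDiff_const, HasCompactSupport.zero, 1, one_pos, by
    intro x hx
    simp [tsupport] at hx⟩

theorem IsTestAwayFrom.add {D : Set (EuclideanSpace ℝ (Fin n))}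
    {φ ψ : EuclideanSpace ℝ (Fin n) → ℂ} (hφ : IsTestAwayFrom D φ) (hψ : IsTestAwayFrom D ψ) :
    IsTestAwayFrom D (φ + ψ) := by
  obtain ⟨h1, h2, ε, hε, h3⟩ := hφ
  obtain ⟨k1, k2, δ, hδ, k3⟩ := hψ
  refine ⟨h1.add k1, h2.add k2, min ε δ, lt_min hε hδ, fun x hx y hy => ?_⟩
  rcases tsupport_add φ ψ hx with hx | hx
  · exact (min_le_left _ _).trans (h3 x hx y hy)
  · exact (min_le_right _ _).trans (k3 x hx y hy)

theorem IsTestAwayFrom.smul {D : Set (EuclideanSpace ℝ (Fin n))}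
    {φ : EuclideanSpace ℝ (Fin n) → ℂ} (c : ℂ) (hφ : IsTestAwayFrom D φ) :
    IsTestAwayFrom D (c • φ) := by
  obtain ⟨h1, h2, ε, hε, h3⟩ := hφ
  have hs : tsupport (c • φ) ⊆ tsupport φ :=
    closure_mono (Function.support_const_smul_subset c φ)
  exact ⟨h1.const_smul c, h2.mono' ((subset_tsupport _).trans hs), ε, hε,
    fun x hx y hy => h3 x (hs hx) y hy⟩

/-- `C_D^∞(O)`: the restrictions to `O` of test functions supported away from `D`, as a subspace
of `W^{1,2}(O)`. -/
def CD (O : Opens (EuclideanSpace ℝ (Fin n))) (D : Set (EuclideanSpace ℝ (Fin n))) :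
    Submodule ℂ (W12 O) where
  carrier := {u | ∃ φ : EuclideanSpace ℝ (Fin n) → ℂ, IsTestAwayFrom D φ ∧
    (u : L2 O) =ᵐ[volume.restrict (O : Set (EuclideanSpace ℝ (Fin n)))] φ}
  zero_mem' := ⟨fun _ => 0, isTestAwayFrom_zero D, Lp.coeFn_zero _ _ _⟩
  add_mem' := by
    rintro u v ⟨φ, hφ, hu⟩ ⟨ψ, hψ, hv⟩
    exact ⟨φ + ψ, hφ.add hψ, (Lp.coeFn_add _ _).trans (hu.add hv)⟩
  smul_mem' := by
    rintro c u ⟨φ, hφ, hu⟩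
    exact ⟨c • φ, hφ.smul c, (Lp.coeFn_smul _ _).trans (hu.const_smul c)⟩

/-- The embedding `u ↦ (u, ∇u)` of `W^{1,2}(O)` into `L²(O) × L²(O)^n`; the topology it induces on
`W^{1,2}(O)` is that of the norm `(‖u‖² + ‖∇u‖²)^{1/2}`. -/
def jet (O : Opens (EuclideanSpace ℝ (Fin n))) : W12 O →ₗ[ℂ] L2 O × L2v O (Fin n) :=
  (W12 O).subtype.prod (grad O)

/-- `W^{1,2}_D(O)`: the closure of `C_D^∞(O)` in `W^{1,2}(O)`. -/
def W12D (O : Opens (EuclideanSpace ℝ (Fin n))) (D : Set (EuclideanSpace ℝ (Fin n))) :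
    Submodule ℂ (W12 O) :=
  ((CD O D).map (jet O)).topologicalClosure.comap (jet O)

/-! ### The operators `∇_D`, `T_D`, `M_D` and the coefficients -/

/-- The gradient `∇_D : 𝕎^{1,2}_D(O) ⊆ L²(O)^m → L²(O)^{nm}` with domain
`𝕎^{1,2}_D(O) = ⨁ i, W^{1,2}_{D i}(O)`; the component `(j, i)` of `∇_D u` is `∂_j (u i)`. -/
def gradD (O : Opens (EuclideanSpace ℝ (Fin n))) (D : Fin m → Set (EuclideanSpace ℝ (Fin n))) :
    L2v O (Fin m) →ₗ.[ℂ] L2v O (Fin n × Fin m) where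
  domain :=
    { carrier := {u | ∀ i, ∃ h : u i ∈ W12 O, (⟨u i, h⟩ : W12 O) ∈ W12D O (D i)}
      zero_mem' := fun i => ⟨(W12 O).zero_mem, (W12D O (D i)).zero_mem⟩
      add_mem' := fun {u v} hu hv i =>
        ⟨(W12 O).add_mem (hu i).1 (hv i).1, (W12D O (D i)).add_mem (hu i).2 (hv i).2⟩
      smul_mem' := fun c u hu i =>
        ⟨(W12 O).smul_mem c (hu i).1, (W12D O (D i)).smul_mem c (hu i).2⟩ }
  toFun :=
    { toFun := fun u => WithLp.toLp 2 fun p => grad O ⟨u.1 p.2, (u.2 p.2).1⟩ p.1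
      map_add' := by
        intro u v
        ext1 p
        have := (grad O).map_add ⟨u.1 p.2, (u.2 p.2).1⟩ ⟨v.1 p.2, (v.2 p.2).1⟩
        exact congrArg (fun g : L2v O (Fin n) => g p.1) this
      map_smul' := by
        intro c u
        ext1 p
        have := (grad O).map_smul c ⟨u.1 p.2, (u.2 p.2).1⟩
        exact congrArg (fun g : L2v O (Fin n) => g p.1) this }

/-- The index set of the `N = (n + 1) m` components of vector fields: `Sum.inl i` is the `i`-th
component of the `L²(O)^m`-part, `Sum.inr (j, i)` a component of the `L²(O)^{nm}`-part. -/
abbrev Idx (n m : ℕ) : Type := Fin m ⊕ (Fin n × Fin m)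

/-- The inhomogeneous gradient `T_D = (1, ∇_D)ᵗ : 𝕎^{1,2}_D(O) ⊆ L²(O)^m → L²(O)^N`. -/
def T (O : Opens (EuclideanSpace ℝ (Fin n))) (D : Fin m → Set (EuclideanSpace ℝ (Fin n))) :
    L2v O (Fin m) →ₗ.[ℂ] L2v O (Idx n m) where
  domain := (gradD O D).domain
  toFun :=
    { toFun := fun u => WithLp.toLp 2 (Sum.elim (fun i => u.1 i) fun p => gradD O D u p)
      map_add' := by
        intro u v
        ext1 k
        rcases k with i | p
        · rfl
        · exact congrArg (fun g : L2v O (Fin n × Fin m) => g p) ((gradD O D).map_add u v)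
      map_smul' := by
        intro c u
        ext1 k
        rcases k with i | p
        · rfl
        · exact congrArg (fun g : L2v O (Fin n × Fin m) => g p) ((gradD O D).map_smul c u) }

/-- `M_D = T_D T_D*`, with maximal domain `{F ∈ dom T_D* : T_D* F ∈ dom T_D}`; `T_D*` is the
Hilbert space adjoint. -/
def M (O : Opens (EuclideanSpace ℝ (Fin n))) (D : Fin m → Set (EuclideanSpace ℝ (Fin n))) :
    L2v O (Idx n m) →ₗ.[ℂ] L2v O (Idx n m) :=
  compMax (T O D) (T O D)†

/-- The multiplication operator on `L²(O)^ι` by a matrix of `L^∞(O)` functions: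
`(B F) k = ∑ l, B k l * F l`. -/
def mulOp {O : Opens (EuclideanSpace ℝ (Fin n))} {ι : Type} [Fintype ι]
    (B : Matrix ι ι (Linf O)) : L2v O ι →L[ℂ] L2v O ι :=
  ((PiLp.continuousLinearEquiv 2 ℂ (fun _ : ι => L2 O)).symm : (ι → L2 O) →L[ℂ] L2v O ι) ∘L
    ContinuousLinearMap.pi fun k => ∑ l,
      ((ContinuousLinearMap.mul ℂ ℂ).holderL
        (volume.restrict (O : Set (EuclideanSpace ℝ (Fin n)))) ∞ 2 2 (B k l)) ∘L
      PiLp.proj 2 (fun _ : ι => L2 O) l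

/-- The multiplication operator acts by pointwise matrix-vector multiplication. -/
theorem mulOp_apply_ae {O : Opens (EuclideanSpace ℝ (Fin n))} {ι : Type} [Fintype ι]
    (B : Matrix ι ι (Linf O)) (F : L2v O ι) (k : ι) :
    (mulOp B F k : L2 O) =ᵐ[volume.restrict (O : Set (EuclideanSpace ℝ (Fin n)))]
      fun x => ∑ l, B k l x * F l x := by
  have h : mulOp B F k = ∑ l, (ContinuousLinearMap.mul ℂ ℂ).holder 2 (B k l) (F l) := by
    simp [mulOp]
  rw [h]
  have h2 : ∀ l, _ := fun l =>
    ContinuousLinearMap.coeFn_holder (r := 2) (ContinuousLinearMap.mul ℂ ℂ) (B k l) (F l)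
  filter_upwards [Lp.coeFn_fun_finsetSum (Finset.univ : Finset ι)
      (fun l => (ContinuousLinearMap.mul ℂ ℂ).holder 2 (B k l) (F l)), ae_all_iff.2 h2]
    with x hx hx2
  rw [hx]
  exact Finset.sum_congr rfl fun l _ => by rw [hx2 l]; rfl

/-- The sesquilinear form
`𝔞(u, v) = ∫_O A∇u · conj ∇v + b u · conj ∇v + (c ∇u) · conj v + (d u) · conj v`
on `𝕎^{1,2}_D(O)`, where `ξ · η = ∑ k, ξ k * η k`. -/
def form (O : Opens (EuclideanSpace ℝ (Fin n))) (D : Fin m → Set (EuclideanSpace ℝ (Fin n)))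
    (A : Matrix (Fin n × Fin m) (Fin n × Fin m) (Linf O))
    (b : Matrix (Fin n × Fin m) (Fin m) (Linf O))
    (c : Matrix (Fin m) (Fin n × Fin m) (Linf O))
    (d : Matrix (Fin m) (Fin m) (Linf O))
    (u v : (gradD O D).domain) : ℂ :=
  ∫ x in (O : Set (EuclideanSpace ℝ (Fin n))),
    ((∑ p, (∑ q, A p q x * gradD O D u q x) * conj (gradD O D v p x))
      + (∑ p, (∑ l, b p l x * u.1 l x) * conj (gradD O D v p x))
      + (∑ k, (∑ q, c k q x * gradD O D u q x) * conj (v.1 k x))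
      + (∑ k, (∑ l, d k l x * u.1 l x) * conj (v.1 k x)))

/-- The inhomogeneous Gårding inequality
`Re 𝔞(u, u) ≥ lam (‖u‖² + ‖∇u‖²)` for all `u ∈ 𝕎^{1,2}_D(O)`, with some `lam > 0`. -/
def Garding (O : Opens (EuclideanSpace ℝ (Fin n))) (D : Fin m → Set (EuclideanSpace ℝ (Fin n)))
    (A : Matrix (Fin n × Fin m) (Fin n × Fin m) (Linf O))
    (b : Matrix (Fin n × Fin m) (Fin m) (Linf O))
    (c : Matrix (Fin m) (Fin n × Fin m) (Linf O))
    (d : Matrix (Fin m) (Fin m) (Linf O)) : Prop :=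
  ∃ lam : ℝ, 0 < lam ∧ ∀ u : (gradD O D).domain,
    lam * (‖u.1‖ ^ 2 + ‖gradD O D u‖ ^ 2) ≤ (form O D A b c d u u).re

/-- The multiplication operator `B` on `L²(O)^N` by the block matrix `[[d, c], [b, A]]`. -/
def coeffOp {O : Opens (EuclideanSpace ℝ (Fin n))}
    (A : Matrix (Fin n × Fin m) (Fin n × Fin m) (Linf O))
    (b : Matrix (Fin n × Fin m) (Fin m) (Linf O))
    (c : Matrix (Fin m) (Fin n × Fin m) (Linf O))
    (d : Matrix (Fin m) (Fin m) (Linf O)) : L2v O (Idx n m) →L[ℂ] L2v O (Idx n m) :=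
  mulOp (Matrix.fromBlocks d c b A)

/-- The operator `M_D B`, with maximal domain `{F : B F ∈ dom M_D}`. -/
def MB (O : Opens (EuclideanSpace ℝ (Fin n))) (D : Fin m → Set (EuclideanSpace ℝ (Fin n)))
    (B : L2v O (Idx n m) →L[ℂ] L2v O (Idx n m)) : L2v O (Idx n m) →ₗ.[ℂ] L2v O (Idx n m) :=
  compMax (M O D) (ofBounded B)

end Kato

end

namespace Kato

/-! ### Geometry of sectors -/

/-! The resolvent equation `z F - M B F = G` is solved not for `F` but for `y = M B F = z F - G`,
which lies in the range `W` of `T`. Let `P` be the projection with `P T u = u`. Since `y = T T* B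
F`, one has `P y = T* B F`, and pairing with `v ∈ W` gives `⟪v, B F⟫ = ⟪P v, P y⟫`. Eliminating `F`
leaves a variational problem on `W` alone: `⟪v, B y⟫ - z ⟪P v, P y⟫ = -⟪v, B G⟫` for all `v ∈ W`.

Gårding's inequality says exactly that `Re ⟪y, B y⟫ ≥ L ‖y‖²` on `W`, so `⟪y, B y⟫` lies in the
sector of angle `arctan (‖B‖ / L) < π / 2`. If `z` stays outside a larger sector, then `⟪y, B y⟫`
and `z ‖P y‖²` cannot cancel, and the left side with `v = y` dominates `L ‖y‖² + |z| ‖P y‖²`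
(`coercive_sub`). As `W` is closed (`isClosed_range_T`), Lax–Milgram gives a unique `y`
(`exists_weakResolvent`), and `F = z⁻¹ (G + y)`. The control of `‖y‖` yields sectoriality; that of
`|z|^(1/2) ‖P y‖ = |z|^(1/2) ‖T* B F‖`, at `z = -t⁻²`, yields the second claim.

The weak problem agrees with the operator equation on maximal domains by `compMax_apply_eq_iff`,
which needs `dom T` to be dense (`dense_domain_T`). -/

theorem abs_arg_le_arctan {a : ℂ} {r s L : ℝ} (hL : 0 < L) (hs : 0 ≤ s) (hr : 0 ≤ r)
    (hre : L * r ≤ a.re) (him : |a.im| ≤ s * r) : |a.arg| ≤ Real.arctan (s / L) := by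
  rcases hr.eq_or_lt with rfl | hr
  · have h0 : a.im = 0 := by simpa using him
    rw [mul_zero] at hre
    rw [Complex.arg_eq_zero_iff.2 ⟨hre, h0⟩, abs_zero]
    exact Real.arctan_nonneg.2 (by positivity)
  · have hpos : 0 < a.re := (mul_pos hL hr).trans_le hre
    have hlt := abs_lt.1 (Complex.abs_arg_lt_pi_div_two_iff.2 (Or.inl hpos))
    rw [← Real.arctan_tan hlt.1 hlt.2, Complex.tan_arg]
    have hq : |a.im / a.re| ≤ s / L := by
      rw [abs_div, abs_of_pos hpos, div_le_div_iff₀ hpos hL]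
      nlinarith
    obtain ⟨h1, h2⟩ := abs_le.1 hq
    rw [abs_le, ← Real.arctan_neg]
    exact ⟨Real.arctan_strictMono.monotone h1, Real.arctan_strictMono.monotone h2⟩

/-- Two complex numbers whose directions differ by at least the angle `φ - θ` cannot cancel. -/
theorem norm_sub_ge_of_arg {a z : ℂ} {θ φ r : ℝ} (ha : |a.arg| ≤ θ) (hz : φ < |z.arg|)
    (hθφ : θ < φ) (hr : 0 ≤ r) :
    √((1 - Real.cos (φ - θ)) / 2) * (‖a‖ + ‖z‖ * r) ≤ ‖a - z * r‖ := by
  have hθ : 0 ≤ θ := (abs_nonneg _).trans ha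
  have hpi := Complex.abs_arg_le_pi z
  set k := Real.cos (φ - θ) with hk
  have hk1 : k ≤ 1 := Real.cos_le_one _
  have hk2 : -1 ≤ k := Real.neg_one_le_cos _
  -- The difference of the arguments lies in `[φ - θ, 2π - (φ - θ)]` in absolute value; the upper
  -- end uses `φ < |arg z| ≤ π`.
  have hcos : Real.cos (a.arg - z.arg) ≤ k := by
    rw [← Real.cos_abs]
    have h1 : φ - θ ≤ |a.arg - z.arg| := by
      have := abs_sub_abs_le_abs_sub z.arg a.arg
      rw [abs_sub_comm] at this
      linarith
    have h2 : |a.arg - z.arg| ≤ 2 * Real.pi - (φ - θ) := by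
      have := abs_sub a.arg z.arg
      linarith
    rcases le_total |a.arg - z.arg| Real.pi with h | h
    · exact Real.cos_le_cos_of_nonneg_of_le_pi (by linarith) h h1
    · rw [← Real.cos_two_pi_sub]
      exact Real.cos_le_cos_of_nonneg_of_le_pi (by linarith) (by linarith) (by linarith)
  -- Law of cosines.
  have hsq : ‖a - z * r‖ ^ 2 =
      ‖a‖ ^ 2 + (‖z‖ * r) ^ 2 - 2 * ‖a‖ * (‖z‖ * r) * Real.cos (a.arg - z.arg) := by
    rw [Real.cos_sub]
    have e1 := Complex.norm_mul_cos_arg a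
    have e2 := Complex.norm_mul_sin_arg a
    have e3 := Complex.norm_mul_cos_arg z
    have e4 := Complex.norm_mul_sin_arg z
    have e5 : 2 * ‖a‖ * (‖z‖ * r) *
        (Real.cos a.arg * Real.cos z.arg + Real.sin a.arg * Real.sin z.arg) =
        2 * r * (a.re * z.re + a.im * z.im) := by
      rw [← e1, ← e2, ← e3, ← e4]; ring
    rw [e5, mul_pow, Complex.sq_norm, Complex.sq_norm, Complex.sq_norm, Complex.normSq_apply,
      Complex.normSq_apply, Complex.normSq_apply]
    simp only [Complex.sub_re, Complex.sub_im, Complex.re_mul_ofReal, Complex.im_mul_ofReal]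
    ring
  refine le_of_sq_le_sq ?_ (norm_nonneg _)
  rw [mul_pow, Real.sq_sqrt (by linarith), hsq]
  have hp := norm_nonneg a
  have hq : 0 ≤ ‖z‖ * r := mul_nonneg (norm_nonneg _) hr
  have h3 := mul_le_mul_of_nonneg_left hcos (mul_nonneg hp hq)
  -- With `p = ‖a‖` and `q = ‖z‖ r`, `p² + q² - 2 k p q - (1 - k) / 2 * (p + q)² = (1 + k) / 2 * (p
  -- - q)²`.
  nlinarith [mul_nonneg (by linarith : (0 : ℝ) ≤ 1 + k) (sq_nonneg (‖a‖ - ‖z‖ * r))]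

theorem sqrt_half_one_sub_cos_pos {θ φ : ℝ} (h : θ < φ) (h0 : 0 ≤ θ) (h1 : φ ≤ Real.pi) :
    0 < √((1 - Real.cos (φ - θ)) / 2) := by
  refine Real.sqrt_pos.2 ?_
  have : Real.cos (φ - θ) < Real.cos 0 :=
    Real.cos_lt_cos_of_nonneg_of_le_pi le_rfl (by linarith) (by linarith)
  rw [Real.cos_zero] at this
  linarith

/-! ### The weak resolvent problem on a closed subspace -/

section Weak

variable {H K : Type*} [NormedAddCommGroup H] [InnerProductSpace ℂ H]
  [NormedAddCommGroup K] [InnerProductSpace ℂ K]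

/-- `y = M B F` in weak form, where `W` is the range of `T`, `P` is a left inverse of `T` and
`M = T T*`. -/
def IsWeakImage (W : Submodule ℂ K) (P : K →L[ℂ] H) (B : K →L[ℂ] K) (F y : K) : Prop :=
  y ∈ W ∧ ∀ v ∈ W, ⟪v, B F⟫_ℂ = ⟪P v, P y⟫_ℂ

variable {W : Submodule ℂ K} {P : K →L[ℂ] H} {B : K →L[ℂ] K} {L : ℝ}

/-- Off-sector coercivity of `⟪x, B x⟫ - z ‖P x‖²`. -/
theorem coercive_sub (hL : 0 < L) (hB : ∀ x ∈ W, L * ‖x‖ ^ 2 ≤ (⟪x, B x⟫_ℂ).re)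
    {φ : ℝ} (hφ : Real.arctan (‖B‖ / L) < φ) {z : ℂ} (hz : φ < |z.arg|) {x : K} (hx : x ∈ W) :
    √((1 - Real.cos (φ - Real.arctan (‖B‖ / L))) / 2) * (L * ‖x‖ ^ 2 + ‖z‖ * ‖P x‖ ^ 2) ≤
      ‖⟪x, B x⟫_ℂ - z * ⟪P x, P x⟫_ℂ‖ := by
  have hn : ‖⟪x, B x⟫_ℂ‖ ≤ ‖B‖ * ‖x‖ ^ 2 := by
    refine (norm_inner_le_norm _ _).trans ?_
    have := mul_le_mul_of_nonneg_left (B.le_opNorm x) (norm_nonneg x)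
    linarith
  have ha := abs_arg_le_arctan hL (norm_nonneg B) (sq_nonneg ‖x‖) (hB x hx) ((Complex.abs_im_le_norm _).trans hn)
  have h := norm_sub_ge_of_arg ha hz hφ (sq_nonneg ‖P x‖)
  rw [inner_self_eq_norm_sq_to_K (𝕜 := ℂ) (P x)]
  push_cast at h
  refine le_trans ?_ h
  gcongr
  exact (hB x hx).trans ((le_abs_self _).trans (Complex.abs_re_le_norm _))

/-- A priori bounds for weak solutions of `z F - M B F = G`. -/
theorem IsWeakImage.bounds {F y : K} (h : IsWeakImage W P B F y) {z : ℂ} {k : ℝ} (hk : 0 < k)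
    (hL : 0 < L)
    (hc : k * (L * ‖y‖ ^ 2 + ‖z‖ * ‖P y‖ ^ 2) ≤ ‖⟪y, B y⟫_ℂ - z * ⟪P y, P y⟫_ℂ‖) :
    ‖y‖ ≤ ‖B‖ / (k * L) * ‖z • F - y‖ ∧
      ‖z‖ * ‖P y‖ ^ 2 ≤ (‖B‖ ^ 2 / (k ^ 2 * L)) * ‖z • F - y‖ ^ 2 := by
  set G := z • F - y with hG
  -- The weak equation tested with `v = y`, after substituting `z F = G + y`.
  have e : ⟪y, B y⟫_ℂ - z * ⟪P y, P y⟫_ℂ = -⟪y, B G⟫_ℂ := by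
    rw [hG, map_sub, map_smul, inner_sub_right, inner_smul_right, h.2 y h.1]
    ring
  have hn : ‖⟪y, B G⟫_ℂ‖ ≤ ‖B‖ * ‖G‖ * ‖y‖ := by
    refine (norm_inner_le_norm _ _).trans ?_
    have := mul_le_mul_of_nonneg_left (B.le_opNorm G) (norm_nonneg y)
    linarith
  rw [e, norm_neg] at hc
  have hy := norm_nonneg y
  have hkL := mul_pos hk hL
  have hz2 : 0 ≤ ‖z‖ * ‖P y‖ ^ 2 := by positivity
  have h1 : ‖y‖ ≤ ‖B‖ / (k * L) * ‖G‖ := by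
    rw [div_mul_eq_mul_div, le_div_iff₀ hkL]
    rcases hy.eq_or_lt with h0 | h0
    · rw [← h0, zero_mul]; positivity
    · refine le_of_mul_le_mul_right ?_ h0
      nlinarith [mul_nonneg hk.le hz2]
  refine ⟨h1, ?_⟩
  have h2 : k * (‖z‖ * ‖P y‖ ^ 2) ≤ ‖B‖ * ‖G‖ * ‖y‖ := by
    nlinarith [mul_nonneg hkL.le (sq_nonneg ‖y‖)]
  have h3 : ‖B‖ * ‖G‖ * ‖y‖ ≤ ‖B‖ * ‖G‖ * (‖B‖ / (k * L) * ‖G‖) := by gcongr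
  have h4 := (le_div_iff₀' hk).2 (h2.trans h3)
  refine h4.trans_eq ?_
  field_simp

/-- Lax–Milgram: the weak resolvent problem has a bounded solution operator. -/
theorem exists_weakResolvent [CompleteSpace K] [CompleteSpace H] (hW : IsClosed (W : Set K))
    {z : ℂ} {k : ℝ} (hz : z ≠ 0) (hk : 0 < k) (hL : 0 < L)
    (hc : ∀ x ∈ W, k * (L * ‖x‖ ^ 2 + ‖z‖ * ‖P x‖ ^ 2) ≤
      ‖⟪x, B x⟫_ℂ - z * ⟪P x, P x⟫_ℂ‖) :
    ∃ R : K →L[ℂ] K, (∀ G, IsWeakImage W P B (R G) (z • R G - G)) ∧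
      ∀ F y, IsWeakImage W P B F y → R (z • F - y) = F := by
  have : CompleteSpace W := hW.completeSpace_coe
  let Q : K →L[ℂ] W := W.orthogonalProjectionOnto
  -- The compression of `B - z P* P` to `W`, which represents the form of the variational problem.
  let f : W →L[ℂ] W := Q ∘L (B - z • (ContinuousLinearMap.adjoint P ∘L P)) ∘L W.subtypeL
  have hf : ∀ x v : W, ⟪v, f x⟫_ℂ = ⟪(v : K), B x⟫_ℂ - z * ⟪P v, P x⟫_ℂ := by
    intro x v
    simp only [f, Q, ContinuousLinearMap.comp_apply,
      Submodule.inner_orthogonalProjectionOnto_eq_of_mem_left]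
    simp [inner_sub_right, inner_smul_right, ContinuousLinearMap.adjoint_inner_right]
  have hu : IsUnit f := by
    refine f.isUnit_of_forall_le_norm_inner_map (c := ⟨k * L, by positivity⟩)
      (mul_pos hk hL) fun x => ?_
    rw [norm_inner_symm, hf x x]
    refine le_trans ?_ (hc x x.2)
    have : 0 ≤ k * (‖z‖ * ‖P x‖ ^ 2) := by positivity
    change ‖(x : K)‖ ^ 2 * (k * L) ≤ _
    linarith
  obtain ⟨g, hg1, hg2⟩ := isUnit_iff_exists.1 hu
  have hfg : ∀ w, f (g w) = w := fun w => by
    simpa using congrArg (fun q : W →L[ℂ] W => q w) hg1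
  have hgf : ∀ w, g (f w) = w := fun w => by
    simpa using congrArg (fun q : W →L[ℂ] W => q w) hg2
  have hsol : ∀ G, z • (z⁻¹ • (G - (g (Q (B G)) : K))) - G = -(g (Q (B G)) : K) := by
    intro G
    rw [smul_inv_smul₀ hz]; abel
  -- The unknown `y = z F - G` must satisfy `f y = -Q B G`; hence `y = -g (Q (B G))` and `F = z⁻¹ (G
  -- + y)`.
  refine ⟨z⁻¹ • (ContinuousLinearMap.id ℂ K - W.subtypeL ∘L g ∘L Q ∘L B), fun G => ?_,
    fun F y hFy => ?_⟩
  · change IsWeakImage W P B (z⁻¹ • (G - (g (Q (B G)) : K)))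
      (z • (z⁻¹ • (G - (g (Q (B G)) : K))) - G)
    rw [hsol]
    refine ⟨W.neg_mem (g (Q (B G))).2, fun v hv => ?_⟩
    have h1 := hf (g (Q (B G))) ⟨v, hv⟩
    rw [hfg] at h1
    simp only [Q, Submodule.inner_orthogonalProjectionOnto_eq_of_mem_left] at h1
    rw [map_smul, map_sub, inner_smul_right, inner_sub_right, map_neg, inner_neg_right, h1]
    field_simp
    simp [Q]
  · obtain ⟨hy, hv⟩ := hFy
    change z⁻¹ • ((z • F - y) - (g (Q (B (z • F - y))) : K)) = F
    have h1 : Q (B (z • F - y)) = f (-⟨y, hy⟩) := by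
      refine ext_inner_left ℂ fun v => ?_
      rw [map_neg, inner_neg_right, hf]
      simp only [Q, Submodule.inner_orthogonalProjectionOnto_eq_of_mem_left]
      rw [map_sub, map_smul, inner_sub_right, inner_smul_right, hv v v.2]
      ring
    rw [h1, hgf]
    simp [smul_smul, hz]

end Weak

/-! ### Application to `T T* B` -/

section Abstract

variable {H K : Type*} [NormedAddCommGroup H] [InnerProductSpace ℂ H] [CompleteSpace H]
  [NormedAddCommGroup K] [InnerProductSpace ℂ K]

theorem mem_adjoint_iff_of_dense {T : H →ₗ.[ℂ] K} (hT : Dense (T.domain : Set H)) {f : K} {w : H} :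
    (∃ h : f ∈ T†.domain, T† ⟨f, h⟩ = w) ↔ ∀ v : T.domain, ⟪T v, f⟫_ℂ = ⟪(v : H), w⟫_ℂ := by
  constructor
  · rintro ⟨h, rfl⟩ v
    have := LinearPMap.adjoint_isFormalAdjoint hT ⟨f, h⟩ v
    rw [← inner_conj_symm, ← this, inner_conj_symm]
  · intro h
    have h' : ∀ v : T.domain, ⟪w, (v : H)⟫_ℂ = ⟪f, T v⟫_ℂ := fun v => by
      rw [← inner_conj_symm, ← h v, inner_conj_symm]
    exact ⟨LinearPMap.mem_adjoint_domain_of_exists f ⟨w, h'⟩,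
      LinearPMap.adjoint_apply_eq hT _ h'⟩

variable {T : H →ₗ.[ℂ] K} {P : K →L[ℂ] H} {B : K →L[ℂ] K}

/-- On `v = T u` the weak equation reads `⟪T u, B F⟫ = ⟪u, P y⟫`, which is the defining relation of
`T*`. This identifies `T* B F` with `P y`, the quantity that the a priori bound controls. -/
theorem weakImage_adjoint (hT : Dense (T.domain : Set H)) (hP : ∀ u : T.domain, P (T u) = u)
    {F y : K} (h : IsWeakImage T.toFun.range P B F y) :
    ∃ hF : B F ∈ T†.domain, T† ⟨B F, hF⟩ = P y := by
  refine (mem_adjoint_iff_of_dense hT).2 fun v => ?_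
  have := h.2 (T v) ⟨v, rfl⟩
  rwa [hP] at this

/-- In the weak form the domain conditions are hidden in `y ∈ range T`: if `y = T u`, then `T* B F =
P y = u` is automatically in `dom T`. -/
theorem compMax_apply_eq_iff (hT : Dense (T.domain : Set H)) (hP : ∀ u : T.domain, P (T u) = u)
    {F y : K} :
    (∃ h : F ∈ (compMax (compMax T T†) (ofBounded B)).domain,
      compMax (compMax T T†) (ofBounded B) ⟨F, h⟩ = y) ↔ IsWeakImage T.toFun.range P B F y := by
  constructor
  · rintro ⟨⟨h1, h2, h3⟩, rfl⟩
    change B F ∈ T†.domain at h2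
    change T† ⟨B F, h2⟩ ∈ T.domain at h3
    have key := (mem_adjoint_iff_of_dense hT).1 ⟨h2, rfl⟩
    change IsWeakImage T.toFun.range P B F (T ⟨T† ⟨B F, h2⟩, h3⟩)
    refine ⟨⟨_, rfl⟩, ?_⟩
    rintro _ ⟨v, rfl⟩
    change ⟪T v, B F⟫_ℂ = ⟪P (T v), P (T ⟨T† ⟨B F, h2⟩, h3⟩)⟫_ℂ
    rw [hP, hP]
    exact key v
  · intro h
    obtain ⟨h2, h3⟩ := weakImage_adjoint hT hP h
    obtain ⟨⟨u, rfl⟩, -⟩ := h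
    change T† ⟨B F, h2⟩ = P (T u) at h3
    rw [hP] at h3
    refine ⟨⟨trivial, h2, show T† ⟨B F, h2⟩ ∈ T.domain from h3 ▸ u.2⟩, ?_⟩
    change T ⟨T† ⟨B F, h2⟩, _⟩ = T u
    congr 1
    exact Subtype.ext h3

theorem isBoundedInverse_iff {E E' : Type*} [NormedAddCommGroup E] [NormedSpace ℂ E]
    [NormedAddCommGroup E'] [NormedSpace ℂ E'] {A : E →ₗ.[ℂ] E'} {R : E' →L[ℂ] E} :
    IsBoundedInverse A R ↔ (∀ f, ∃ h : R f ∈ A.domain, A ⟨R f, h⟩ = f) ∧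
      ∀ u (h : u ∈ A.domain), R (A ⟨u, h⟩) = u :=
  ⟨fun h => ⟨h.1, fun u hu => h.2 ⟨u, hu⟩⟩, fun h => ⟨h.1, fun u => h.2 u.1 u.2⟩⟩

/-- Here `A` enters only through its graph, so that `IsWeakImage` can be substituted for it. -/
theorem isResolventAt_iff {E : Type*} [NormedAddCommGroup E] [NormedSpace ℂ E]
    {A : E →ₗ.[ℂ] E} {z : ℂ} {R : E →L[ℂ] E} :
    IsResolventAt A z R ↔ (∀ G, ∃ h : R G ∈ A.domain, A ⟨R G, h⟩ = z • R G - G) ∧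
      ∀ F y, (∃ h : F ∈ A.domain, A ⟨F, h⟩ = y) → R (z • F - y) = F := by
  rw [IsResolventAt, isBoundedInverse_iff]
  refine and_congr (forall_congr' fun G => ⟨?_, ?_⟩) ⟨?_, ?_⟩
  · rintro ⟨h, e⟩
    refine ⟨h.2, ?_⟩
    change z • R G - A ⟨R G, h.2⟩ = G at e
    exact eq_sub_iff_add_eq'.2 (sub_eq_iff_eq_add.1 e).symm
  · rintro ⟨h, e⟩
    refine ⟨⟨trivial, h⟩, ?_⟩
    change z • R G - A ⟨R G, h⟩ = G
    rw [e]; abel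
  · rintro hR F _ ⟨h, rfl⟩
    exact hR F ⟨trivial, h⟩
  · intro hR F h
    exact hR F _ ⟨h.2, rfl⟩

/-- Sectoriality of `T T* B` for `B` accretive on the (closed) range of `T`. -/
theorem isSectorialOfAngle_compMax [CompleteSpace K] (hT : Dense (T.domain : Set H))
    (hP : ∀ u : T.domain, P (T u) = u) (hW : IsClosed (T.toFun.range : Set K))
    {L : ℝ} (hL : 0 < L) (hB : ∀ u : T.domain, L * ‖T u‖ ^ 2 ≤ (⟪T u, B (T u)⟫_ℂ).re) :
    IsSectorialOfAngle (compMax (compMax T T†) (ofBounded B)) (Real.arctan (‖B‖ / L)) := by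
  have hB' : ∀ x ∈ T.toFun.range, L * ‖x‖ ^ 2 ≤ (⟪x, B x⟫_ℂ).re := by
    rintro _ ⟨u, rfl⟩
    exact hB u
  have h0 : 0 ≤ Real.arctan (‖B‖ / L) := Real.arctan_nonneg.2 (by positivity)
  constructor
  · intro z hz
    by_contra hzs
    -- Coercivity needs an angle strictly between that of the sector and `|arg z|`, since its
    -- constant vanishes at `φ = θ`.
    obtain ⟨φ, hφ1, hφ2⟩ := exists_between (not_le.1 (Set.notMem_ofPred_iff.1 hzs))
    have hz0 : z ≠ 0 := by
      rintro rfl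
      simp [closedSector, h0] at hzs
    obtain ⟨R, hR1, hR2⟩ := exists_weakResolvent hW hz0
      (sqrt_half_one_sub_cos_pos hφ1 h0 (hφ2.le.trans (Complex.abs_arg_le_pi z))) hL
      (fun x hx => coercive_sub (P := P) hL hB' hφ1 hφ2 hx)
    refine hz ⟨R, isResolventAt_iff.2 ⟨fun G => (compMax_apply_eq_iff hT hP).2 (hR1 G),
      fun F y h => hR2 F y ((compMax_apply_eq_iff hT hP).1 h)⟩⟩
  · intro φ hφ1 hφ2
    have hk := sqrt_half_one_sub_cos_pos hφ1 h0 hφ2.le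
    -- From `z R G = G + y` and the a priori bound for `‖y‖`.
    refine ⟨1 + ‖B‖ / (√((1 - Real.cos (φ - Real.arctan (‖B‖ / L))) / 2) * L),
      fun z hz R hR => ?_⟩
    refine ContinuousLinearMap.opNorm_le_bound _ (by positivity) fun G => ?_
    have h := (compMax_apply_eq_iff hT hP).1 ((isResolventAt_iff.1 hR).1 G)
    have hb := (h.bounds hk hL (coercive_sub hL hB' hφ1 (not_le.1 hz) h.1)).1
    rw [sub_sub_cancel] at hb
    rw [smul_apply, add_mul, one_mul]
    calc ‖z • R G‖ = ‖G + (z • R G - G)‖ := by rw [add_sub_cancel]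
      _ ≤ ‖G‖ + ‖z • R G - G‖ := norm_add_le _ _
      _ ≤ _ := by gcongr

/-- Uniform bounds for `t T* B (1 + t² T T* B)⁻¹`. -/
theorem exists_uniform_bound_adjoint_comp_resolvent [CompleteSpace K]
    (hT : Dense (T.domain : Set H))
    (hP : ∀ u : T.domain, P (T u) = u) (hW : IsClosed (T.toFun.range : Set K))
    {L : ℝ} (hL : 0 < L) (hB : ∀ u : T.domain, L * ‖T u‖ ^ 2 ≤ (⟪T u, B (T u)⟫_ℂ).re) :
    ∃ C : ℝ, ∀ t : ℝ, 0 < t → ∃ R : K →L[ℂ] K,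
      IsBoundedInverse (ofBounded (ContinuousLinearMap.id ℂ K)
        + ((t : ℂ) ^ 2) • compMax (compMax T T†) (ofBounded B)) R ∧
      ∃ S : K →L[ℂ] H, (t : ℂ) • compMax T† (ofBounded (B ∘L R)) = ofBounded S ∧ ‖S‖ ≤ C := by
  have hB' : ∀ x ∈ T.toFun.range, L * ‖x‖ ^ 2 ≤ (⟪x, B x⟫_ℂ).re := by
    rintro _ ⟨u, rfl⟩
    exact hB u
  have h0 : 0 ≤ Real.arctan (‖B‖ / L) := Real.arctan_nonneg.2 (by positivity)
  have hφ1 := Real.arctan_lt_pi_div_two (‖B‖ / L)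
  have hpi := Real.pi_pos
  have hk := sqrt_half_one_sub_cos_pos hφ1 h0 (by linarith)
  set k := √((1 - Real.cos (Real.pi / 2 - Real.arctan (‖B‖ / L))) / 2) with hk_def
  refine ⟨√(‖B‖ ^ 2 / (k ^ 2 * L)), fun t ht => ?_⟩
  have htc : (t : ℂ) ≠ 0 := by exact_mod_cast ht.ne'
  -- `1 + t² M B = z⁻¹ (z - M B)`, so its inverse is `z` times the resolvent at `z`. As `z` is
  -- negative, `φ = π / 2` serves for all `t`, and `k` does not depend on `t`.
  set z : ℂ := -((t : ℂ) ^ 2)⁻¹ with hz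
  have hz' : z = ((-(t ^ 2)⁻¹ : ℝ) : ℂ) := by rw [hz]; push_cast; rfl
  have hzneg : -(t ^ 2)⁻¹ < 0 := by
    have : 0 < (t ^ 2)⁻¹ := by positivity
    linarith
  have hz0 : z ≠ 0 := by rw [hz]; simp [htc]
  have hzt : (t : ℂ) ^ 2 * z = -1 := by rw [hz]; field_simp
  have hznorm : ‖z‖ = (t ^ 2)⁻¹ := by
    rw [hz', Complex.norm_real, Real.norm_eq_abs, abs_of_neg hzneg, neg_neg]
  have hzarg : Real.pi / 2 < |z.arg| := by
    rw [hz', Complex.arg_ofReal_of_neg hzneg, abs_of_pos hpi]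
    linarith
  have hc : ∀ x ∈ T.toFun.range, k * (L * ‖x‖ ^ 2 + ‖z‖ * ‖P x‖ ^ 2) ≤
      ‖⟪x, B x⟫_ℂ - z * ⟪P x, P x⟫_ℂ‖ := fun x hx => coercive_sub hL hB' hφ1 hzarg hx
  obtain ⟨R₀, hR1, hR2⟩ := exists_weakResolvent hW hz0 hk hL hc
  have hR : ∀ G, IsWeakImage T.toFun.range P B ((z • R₀) G) (z • ((z • R₀) G - G)) := by
    intro G
    have := hR1 (z • G)
    rwa [map_smul, ← smul_sub] at this
  refine ⟨z • R₀, isBoundedInverse_iff.2 ⟨fun G => ?_, fun F hF => ?_⟩,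
    (t : ℂ) • P ∘L (z • (z • R₀ - ContinuousLinearMap.id ℂ K)), ?_, ?_⟩
  · obtain ⟨h, e⟩ := (compMax_apply_eq_iff hT hP).2 (hR G)
    refine ⟨⟨trivial, h⟩, ?_⟩
    change (z • R₀) G + (t : ℂ) ^ 2 • (compMax (compMax T T†) (ofBounded B)) ⟨(z • R₀) G, h⟩ = G
    rw [e, smul_smul, hzt, neg_one_smul]
    abel
  · have h := (compMax_apply_eq_iff hT hP).1 ⟨hF.2, rfl⟩
    have := hR2 F _ h
    change (z • R₀) (F + (t : ℂ) ^ 2 • (compMax (compMax T T†) (ofBounded B)) ⟨F, hF.2⟩) = F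
    rw [smul_apply, ← map_smul, smul_add, smul_smul, mul_comm z, hzt,
      neg_one_smul, ← sub_eq_add_neg]
    exact this
  · have hdom : ∀ G, ∃ h : (B ∘L (z • R₀)) G ∈ T†.domain,
        T† ⟨(B ∘L (z • R₀)) G, h⟩ = P (z • ((z • R₀) G - G)) :=
      fun G => weakImage_adjoint hT hP (hR G)
    refine LinearPMap.ext (Submodule.ext fun G => ?_) fun G h1 h2 => ?_
    · exact ⟨fun _ => trivial, fun _ => ⟨trivial, (hdom G).1⟩⟩
    · obtain ⟨h, e⟩ := hdom G
      change (t : ℂ) • T† ⟨(B ∘L (z • R₀)) G, h⟩ = (t : ℂ) • P (z • ((z • R₀) G - G))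
      rw [e]
  · refine ContinuousLinearMap.opNorm_le_bound _ (Real.sqrt_nonneg _) fun G => ?_
    change ‖(t : ℂ) • P (z • ((z • R₀) G - G))‖ ≤ _
    have hb := ((hR G).bounds hk hL (hc _ (hR G).1)).2
    rw [← smul_sub, sub_sub_cancel, norm_smul, hznorm] at hb
    rw [norm_smul, Complex.norm_real, Real.norm_of_nonneg ht.le]
    refine le_of_sq_le_sq ?_ (by positivity)
    rw [mul_pow, mul_pow, Real.sq_sqrt (by positivity)]
    have ht2 : 0 < t ^ 2 := by positivity
    -- With data `z G` the bound is `t⁻² ‖P y‖² ≤ C t⁻⁴ ‖G‖²`; multiplying by `t⁴` removes `t` from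
    -- the right side.
    have h5 := mul_le_mul_of_nonneg_left hb (by positivity : 0 ≤ (t ^ 2) ^ 2)
    refine (Eq.trans_le ?_ h5).trans_eq ?_
    · field_simp
    · field_simp

end Abstract

variable {n m : ℕ}

/-! ### The inhomogeneous gradient `T` -/

theorem continuous_integral_mul_test (O : Opens (EuclideanSpace ℝ (Fin n)))
    {ψ : EuclideanSpace ℝ (Fin n) → ℂ} (hψ : Continuous ψ) (hc : HasCompactSupport ψ) :
    Continuous fun u : L2 O => ∫ x in (O : Set (EuclideanSpace ℝ (Fin n))), u x * ψ x := by
  have hm : MemLp (fun x => conj (ψ x)) 2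
      (volume.restrict (O : Set (EuclideanSpace ℝ (Fin n)))) :=
    (hψ.memLp_of_hasCompactSupport hc).star
  have e : (fun u : L2 O => ∫ x in (O : Set (EuclideanSpace ℝ (Fin n))), u x * ψ x) =
      fun u => ⟪hm.toLp _, u⟫_ℂ := by
    funext u
    rw [L2.inner_def]
    refine integral_congr_ae ?_
    filter_upwards [hm.coeFn_toLp] with x hx
    rw [hx, RCLike.inner_apply, RCLike.conj_conj]
  rw [e]
  fun_prop

/-- Each test function and each direction impose an equation between `L²`-continuous functionals.
Thus the weak gradient is a closed operator. -/
theorem isClosed_isWeakGradient (O : Opens (EuclideanSpace ℝ (Fin n))) :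
    IsClosed {p : L2 O × L2v O (Fin n) | IsWeakGradient O p.1 p.2} := by
  simp only [IsWeakGradient, Set.ofPred_forall]
  refine isClosed_iInter fun φ => isClosed_iInter fun hφ => isClosed_iInter fun hc =>
    isClosed_iInter fun _ => isClosed_iInter fun j => isClosed_eq ?_ ?_
  · exact (continuous_integral_mul_test O (continuous_pderiv hφ _)
      (hasCompactSupport_pderiv hc _)).comp continuous_fst
  · exact ((continuous_integral_mul_test O hφ.continuous hc).comp
      ((PiLp.continuous_apply 2 _ j).comp continuous_snd)).neg

/-- Limits of pairs `(u, ∇u)` are again such pairs because the weak gradient is closed. The closure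
taken in `L² × (L²)ⁿ` therefore contains nothing beyond the jets of `W^{1,2}_D(O)`. -/
theorem exists_mem_W12D_iff {O : Opens (EuclideanSpace ℝ (Fin n))}
    {D : Set (EuclideanSpace ℝ (Fin n))} {p : L2 O × L2v O (Fin n)} :
    (∃ h : p.1 ∈ W12 O, (⟨p.1, h⟩ : W12 O) ∈ W12D O D ∧ grad O ⟨p.1, h⟩ = p.2) ↔
      p ∈ ((CD O D).map (jet O)).topologicalClosure := by
  constructor
  · rintro ⟨h, hD, hg⟩
    have e : jet O ⟨p.1, h⟩ = p := Prod.ext rfl hg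
    rw [← e]
    exact hD
  · intro hp
    have hw : IsWeakGradient O p.1 p.2 := by
      refine closure_minimal ?_ (isClosed_isWeakGradient O) hp
      rintro _ ⟨u, -, rfl⟩
      exact grad_spec O u
    have hg : grad O ⟨p.1, p.2, hw⟩ = p.2 := (grad_spec O _).unique hw
    refine ⟨⟨p.2, hw⟩, ?_, hg⟩
    have e : jet O ⟨p.1, p.2, hw⟩ = p := Prod.ext rfl hg
    change jet O ⟨p.1, p.2, hw⟩ ∈ ((CD O D).map (jet O)).topologicalClosure
    rw [e]
    exact hp

/-- Membership in the range decouples into one condition for each `i`, namely that the `i`-th block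
of `F` lies in a closed space of jets. -/
theorem isClosed_range_T (O : Opens (EuclideanSpace ℝ (Fin n)))
    (D : Fin m → Set (EuclideanSpace ℝ (Fin n))) :
    IsClosed ((T O D).toFun.range : Set (L2v O (Idx n m))) := by
  have e : ((T O D).toFun.range : Set (L2v O (Idx n m))) =
      ⋂ i, {F | ((F (Sum.inl i), WithLp.toLp 2 fun j => F (Sum.inr (j, i))) :
        L2 O × L2v O (Fin n)) ∈ ((CD O (D i)).map (jet O)).topologicalClosure} := by
    ext F
    simp only [Set.mem_iInter, Set.mem_ofPred_eq, ← exists_mem_W12D_iff]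
    constructor
    · rintro ⟨u, rfl⟩ i
      exact ⟨(u.2 i).1, (u.2 i).2, rfl⟩
    · intro h
      refine ⟨⟨WithLp.toLp 2 fun i => F (Sum.inl i), fun i => ⟨(h i).1, (h i).2.1⟩⟩, ?_⟩
      ext1 k
      rcases k with i | ⟨j, i⟩
      · rfl
      · exact congrArg (fun g : L2v O (Fin n) => g j) (h i).2.2
  rw [e]
  refine isClosed_iInter fun i => (Submodule.isClosed_topologicalClosure _).preimage ?_
  fun_prop

/-- The projection of `L²(O)^N` onto `L²(O)^m`, a left inverse of `T`. -/
noncomputable def lowerPart (O : Opens (EuclideanSpace ℝ (Fin n))) :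
    L2v O (Idx n m) →L[ℂ] L2v O (Fin m) :=
  ((PiLp.continuousLinearEquiv 2 ℂ (fun _ : Fin m => L2 O)).symm :
      (Fin m → L2 O) →L[ℂ] L2v O (Fin m)) ∘L
    ContinuousLinearMap.pi fun i => PiLp.proj 2 (fun _ : Idx n m => L2 O) (Sum.inl i)

theorem lowerPart_T (O : Opens (EuclideanSpace ℝ (Fin n)))
    (D : Fin m → Set (EuclideanSpace ℝ (Fin n))) (u : (T O D).domain) :
    lowerPart O (T O D u) = u := rfl

/-- The open set `O` misses its frontier, and a compact set has positive distance from a disjoint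
closed set. -/
theorem isTestAwayFrom_of_tsupport_subset {O : Opens (EuclideanSpace ℝ (Fin n))}
    {D : Set (EuclideanSpace ℝ (Fin n))} (hc : IsClosed D)
    (hD : D ⊆ frontier (O : Set (EuclideanSpace ℝ (Fin n))))
    {φ : EuclideanSpace ℝ (Fin n) → ℂ} (hφ : ContDiff ℝ ∞ φ) (hφc : HasCompactSupport φ)
    (hφO : tsupport φ ⊆ O) : IsTestAwayFrom D φ := by
  have hdisj : Disjoint (tsupport φ) D := by
    refine Set.disjoint_left.2 fun x hx hxD => ?_
    have := hD hxD
    rw [O.isOpen.frontier_eq] at this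
    exact this.2 (hφO hx)
  obtain ⟨ε, hε, h⟩ := Metric.exists_pos_forall_lt_edist hφc.isCompact hc hdisj
  refine ⟨hφ, hφc, ε, by exact_mod_cast hε, fun x hx y hy => ?_⟩
  have := h x hx y hy
  rw [edist_nndist, ENNReal.coe_lt_coe] at this
  exact_mod_cast this.le

/-- Integration by parts on all of `ℝⁿ`: only `φ` has to be supported in `O` for the integrals over
`O` to extend, so `ψ` may be nonzero on the boundary. -/
theorem isWeakGradient_of_contDiff {O : Opens (EuclideanSpace ℝ (Fin n))}
    {ψ : EuclideanSpace ℝ (Fin n) → ℂ} (hψ : ContDiff ℝ ∞ ψ) (hψc : HasCompactSupport ψ)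
    (hm : MemLp ψ 2 (volume.restrict (O : Set (EuclideanSpace ℝ (Fin n)))))
    (hd : ∀ j, MemLp (fun x => fderiv ℝ ψ x (EuclideanSpace.single j 1)) 2
      (volume.restrict (O : Set (EuclideanSpace ℝ (Fin n))))) :
    IsWeakGradient O (hm.toLp ψ) (WithLp.toLp 2 fun j => (hd j).toLp _) := by
  intro φ hφ hφc hφO j
  set v : EuclideanSpace ℝ (Fin n) := EuclideanSpace.single j 1
  have e1 : ∫ x in (O : Set (EuclideanSpace ℝ (Fin n))), (hm.toLp ψ) x * fderiv ℝ φ x v =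
      ∫ x, ψ x * fderiv ℝ φ x v := by
    refine Eq.trans ?_ (setIntegral_eq_integral_of_forall_compl_eq_zero
      (s := (O : Set (EuclideanSpace ℝ (Fin n)))) fun x hx => ?_)
    · refine integral_congr_ae ?_
      filter_upwards [hm.coeFn_toLp] with x h
      rw [h]
    · have : x ∉ tsupport (fderiv ℝ φ) := fun h => hx (hφO (tsupport_fderiv_subset (𝕜 := ℝ) h))
      rw [image_eq_zero_of_notMem_tsupport this]
      simp
  have e2 : ∫ x in (O : Set (EuclideanSpace ℝ (Fin n))), (hd j).toLp _ x * φ x =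
      ∫ x, fderiv ℝ ψ x v * φ x := by
    refine Eq.trans ?_ (setIntegral_eq_integral_of_forall_compl_eq_zero
      (s := (O : Set (EuclideanSpace ℝ (Fin n)))) fun x hx => ?_)
    · refine integral_congr_ae ?_
      filter_upwards [(hd j).coeFn_toLp] with x h
      rw [h]
    · have : x ∉ tsupport φ := fun h => hx (hφO h)
      rw [image_eq_zero_of_notMem_tsupport this, mul_zero]
  rw [e1]
  refine Eq.trans ?_ (congrArg Neg.neg e2.symm)
  have cψ := hψ.continuous
  have cφ := hφ.continuous
  have cψ' := continuous_pderiv hψ v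
  have cφ' := continuous_pderiv hφ v
  exact integral_mul_fderiv_eq_neg_fderiv_mul_of_integrable
    ((cψ'.mul cφ).integrable_of_hasCompactSupport hφc.mul_left)
    ((cψ.mul cφ').integrable_of_hasCompactSupport hψc.mul_right)
    ((cψ.mul cφ).integrable_of_hasCompactSupport hφc.mul_left)
    (fun x _ => hψ.differentiable (by simp) x) (fun x _ => hφ.differentiable (by simp) x)

/-- `C_0^∞(O) ⊆ W^{1,2}_D(O)`. -/
theorem exists_mem_W12D_of_contDiff {O : Opens (EuclideanSpace ℝ (Fin n))}
    {D : Set (EuclideanSpace ℝ (Fin n))} (hc : IsClosed D)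
    (hD : D ⊆ frontier (O : Set (EuclideanSpace ℝ (Fin n))))
    {φ : EuclideanSpace ℝ (Fin n) → ℂ} (hφ : ContDiff ℝ ∞ φ) (hφc : HasCompactSupport φ)
    (hφO : tsupport φ ⊆ O)
    (hm : MemLp φ 2 (volume.restrict (O : Set (EuclideanSpace ℝ (Fin n))))) :
    ∃ h : hm.toLp φ ∈ W12 O, (⟨hm.toLp φ, h⟩ : W12 O) ∈ W12D O D := by
  have hd : ∀ j, MemLp (fun x => fderiv ℝ φ x (EuclideanSpace.single j 1)) 2
      (volume.restrict (O : Set (EuclideanSpace ℝ (Fin n)))) := fun j =>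
    (continuous_pderiv hφ _).memLp_of_hasCompactSupport (hasCompactSupport_pderiv hφc _)
  have hw : hm.toLp φ ∈ W12 O := ⟨_, isWeakGradient_of_contDiff hφ hφc hm hd⟩
  refine ⟨hw, subset_closure ⟨_, ?_, rfl⟩⟩
  exact ⟨φ, isTestAwayFrom_of_tsupport_subset hc hD hφ hφc hφO, hm.coeFn_toLp⟩

/-- A field orthogonal to the domain is orthogonal to every test function in `C_0^∞(O)` placed in a
single component, so it vanishes by the fundamental lemma of the calculus of variations. -/
theorem dense_domain_T (O : Opens (EuclideanSpace ℝ (Fin n)))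
    (D : Fin m → Set (EuclideanSpace ℝ (Fin n))) (hc : ∀ i, IsClosed (D i))
    (hD : ∀ i, D i ⊆ frontier (O : Set (EuclideanSpace ℝ (Fin n)))) :
    Dense ((T O D).domain : Set (L2v O (Fin m))) := by
  rw [Submodule.dense_iff_topologicalClosure_eq_top, Submodule.topologicalClosure_eq_top_iff,
    Submodule.eq_bot_iff]
  intro f hf
  ext1 i
  apply (Lp.eq_zero_iff_ae_eq_zero).2
  have hO := O.isOpen
  have key : ∀ᵐ x ∂(volume.restrict (O : Set (EuclideanSpace ℝ (Fin n)))),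
      x ∈ (O : Set (EuclideanSpace ℝ (Fin n))) → f i x = 0 := by
    refine hO.ae_eq_zero_of_integral_contDiff_smul_eq_zero ?_ ?_
    · exact ((Lp.memLp (f i)).locallyIntegrable (by norm_num)).locallyIntegrableOn _
    · intro φ hφ hφc hφO
      have hφ' : ContDiff ℝ ∞ (fun x => (φ x : ℂ)) := Complex.ofRealCLM.contDiff.comp hφ
      have hφc' : HasCompactSupport (fun x => (φ x : ℂ)) :=
        hφc.comp_left (g := fun r : ℝ => (r : ℂ)) Complex.ofReal_zero
      have hφO' : tsupport (fun x => (φ x : ℂ)) ⊆ O :=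
        (closure_mono (Function.support_comp_subset Complex.ofReal_zero φ)).trans hφO
      have hm : MemLp (fun x => (φ x : ℂ)) 2
          (volume.restrict (O : Set (EuclideanSpace ℝ (Fin n)))) :=
        hφ'.continuous.memLp_of_hasCompactSupport hφc'
      have hmem : (PiLp.single 2 i (hm.toLp _) : L2v O (Fin m)) ∈ (T O D).domain := by
        intro k
        by_cases hk : k = i
        · subst hk
          have := exists_mem_W12D_of_contDiff (hc k) (hD k) hφ' hφc' hφO' hm
          simpa using this
        · have e : (PiLp.single 2 i (hm.toLp _) : L2v O (Fin m)) k = 0 := by simp [hk]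
          rw [e]
          exact ⟨(W12 O).zero_mem, (W12D O (D k)).zero_mem⟩
      have h0 := hf _ hmem
      rw [PiLp.inner_apply, Finset.sum_eq_single i (by intro k _ hk; simp [hk]) (by simp)] at h0
      rw [PiLp.single_eq_same, L2.inner_def] at h0
      rw [← h0]
      refine integral_congr_ae ?_
      filter_upwards [hm.coeFn_toLp] with x hx
      rw [hx, RCLike.inner_apply, Complex.conj_ofReal, Complex.real_smul, mul_comm]
  filter_upwards [key, ae_restrict_mem hO.measurableSet] with x hx hxO
  exact hx hxO

/-! ### The form in terms of `T` and the coefficient operator -/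

theorem norm_T_sq (O : Opens (EuclideanSpace ℝ (Fin n)))
    (D : Fin m → Set (EuclideanSpace ℝ (Fin n))) (u : (T O D).domain) :
    ‖T O D u‖ ^ 2 = ‖u.1‖ ^ 2 + ‖gradD O D u‖ ^ 2 := by
  rw [PiLp.norm_sq_eq_of_L2, PiLp.norm_sq_eq_of_L2, PiLp.norm_sq_eq_of_L2, Fintype.sum_sum_type]
  rfl

theorem inner_mulOp {O : Opens (EuclideanSpace ℝ (Fin n))} {ι : Type} [Fintype ι]
    (B : Matrix ι ι (Linf O)) (F G : L2v O ι) :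
    ⟪G, mulOp B F⟫_ℂ = ∫ x in (O : Set (EuclideanSpace ℝ (Fin n))),
      ∑ k, (∑ l, B k l x * F l x) * conj (G k x) := by
  simp only [PiLp.inner_apply, L2.inner_def]
  rw [← integral_finsetSum _ fun k _ => L2.integrable_inner (𝕜 := ℂ) (G k) (mulOp B F k)]
  refine integral_congr_ae ?_
  filter_upwards [ae_all_iff.2 (mulOp_apply_ae B F)] with x hx
  refine Finset.sum_congr rfl fun k _ => ?_
  rw [hx k, RCLike.inner_apply]

/-- Together with `norm_T_sq`, this turns Gårding's inequality into accretivity of `B` on the range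
of `T`. -/
theorem form_eq_inner (O : Opens (EuclideanSpace ℝ (Fin n)))
    (D : Fin m → Set (EuclideanSpace ℝ (Fin n)))
    (A : Matrix (Fin n × Fin m) (Fin n × Fin m) (Linf O))
    (b : Matrix (Fin n × Fin m) (Fin m) (Linf O))
    (c : Matrix (Fin m) (Fin n × Fin m) (Linf O))
    (d : Matrix (Fin m) (Fin m) (Linf O)) (u v : (T O D).domain) :
    form O D A b c d u v = ⟪T O D v, coeffOp A b c d (T O D u)⟫_ℂ := by
  rw [coeffOp, inner_mulOp]
  refine integral_congr_ae (Filter.Eventually.of_forall fun x => ?_)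
  simp only [Fintype.sum_sum_type, Matrix.fromBlocks_apply₁₁, Matrix.fromBlocks_apply₁₂,
    Matrix.fromBlocks_apply₂₁, Matrix.fromBlocks_apply₂₂, add_mul, Finset.sum_add_distrib]
  change _ = (∑ k, (∑ l, d k l x * u.1 l x) * conj (v.1 k x)) +
    (∑ p, (∑ l, b p l x * u.1 l x) * conj (gradD O D v p x)) +
    ((∑ k, (∑ q, c k q x * gradD O D u q x) * conj (v.1 k x)) +
      ∑ p, (∑ q, A p q x * gradD O D u q x) * conj (gradD O D v p x))
  ring

end Kato

/-! ### Sectoriality of `M_D B` and the uniform bounds -/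

theorem lemma3p8 {n m : ℕ}
    (O : TopologicalSpace.Opens (EuclideanSpace ℝ (Fin n)))
    (D : Fin m → Set (EuclideanSpace ℝ (Fin n)))
    (hDclosed : ∀ i, IsClosed (D i))
    (hDfrontier : ∀ i, D i ⊆ frontier (O : Set (EuclideanSpace ℝ (Fin n))))
    (A : Matrix (Fin n × Fin m) (Fin n × Fin m) (Kato.Linf O))
    (b : Matrix (Fin n × Fin m) (Fin m) (Kato.Linf O))
    (c : Matrix (Fin m) (Fin n × Fin m) (Kato.Linf O))
    (d : Matrix (Fin m) (Fin m) (Kato.Linf O))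
    (hG : Kato.Garding O D A b c d) :
    (∃ θ : ℝ, 0 ≤ θ ∧ θ < Real.pi / 2 ∧
      Kato.IsSectorialOfAngle (Kato.MB O D (Kato.coeffOp A b c d)) θ) ∧
    (∃ C : ℝ, ∀ t : ℝ, 0 < t →
      ∃ R : Kato.L2v O (Kato.Idx n m) →L[ℂ] Kato.L2v O (Kato.Idx n m),
        Kato.IsBoundedInverse
          (Kato.ofBounded (ContinuousLinearMap.id ℂ (Kato.L2v O (Kato.Idx n m)))
            + ((t : ℂ) ^ 2) • Kato.MB O D (Kato.coeffOp A b c d)) R ∧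
        ∃ S : Kato.L2v O (Kato.Idx n m) →L[ℂ] Kato.L2v O (Fin m),
          (t : ℂ) • Kato.compMax (Kato.T O D)†
            (Kato.ofBounded (Kato.coeffOp A b c d ∘L R)) = Kato.ofBounded S ∧
          ‖S‖ ≤ C) := by
  obtain ⟨lam, hlam, h⟩ := hG
  have hT := Kato.dense_domain_T O D hDclosed hDfrontier
  have hB : ∀ u : (Kato.T O D).domain, lam * ‖Kato.T O D u‖ ^ 2 ≤
      (inner ℂ (Kato.T O D u) (Kato.coeffOp A b c d (Kato.T O D u))).re := fun u => by
    rw [Kato.norm_T_sq, ← Kato.form_eq_inner]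
    exact h u
  have hP := Kato.lowerPart_T O D
  have hW := Kato.isClosed_range_T O D
  -- The angle is `arctan (‖B‖ / lam)`, with `B` the coefficient operator.
  exact ⟨⟨_, Real.arctan_nonneg.2 (by positivity), Real.arctan_lt_pi_div_two _,
    Kato.isSectorialOfAngle_compMax hT hP hW hlam hB⟩,
    Kato.exists_uniform_bound_adjoint_comp_resolvent hT hP hW hlam hB⟩
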